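/- Let $m\ge 0$ and let $K$ be a simplicial complex on $[m]=\{1,\dots,m\}$, that is, a family of subsets of $[m]$ (its simplices) that contains $\varnothing$ and is closed under taking subsets. (It is not required that every singleton $\{i\}$ be a simplex.) Let $N(K)$ be the set of minimal non-simplices of $K$: the sets $\omega\subseteq[m]$ with $\omega\notin K$ all of whose proper subsets belong to $K$. Let $$\mathcal Z_K=\{z\in\mathbb C^m:\ |z_i|\le 1 \text{ for all } i,\ \{i: |z_i|\neq 1\}\in K\}$$ be the moment-angle complex, on which the torus $T^m=(S^1)^m$ acts by coordinatewise multiplication. The Buchstaber invariant $s(K)$ is the maximal $s$ for which there is a subgroup $H\subseteq T^m$, isomorphic to $T^s$ as a topological group, that acts freely on $\mathcal Z_K$. Then: 1. $s(K)=0$ if and only if $N(K)=\varnothing$; equivalently, if and only if $K$ is the full simplex on $[m]$ (every subset of $[m]$ is a simplex). 2. $s(K)=1$ if and only if $N(K)\ne\varnothing$ and any two and any three distinct sets in $N(K)$ have nonempty intersection. 3. $s(K)=2$ if and only if some two or some three distinct sets in $N(K)$ have empty intersection and $N(K)$ contains none of the following five configurations of pairwise distinct sets: (i) $\tau_1,\dots,\tau_7$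 with $\tau_1\cap\tau_2\cap\tau_4=\tau_1\cap\tau_3\cap\tau_5=\tau_1\cap\tau_6\cap\tau_7=\tau_2\cap\tau_3\cap\tau_6=\tau_2\cap\tau_5\cap\tau_7=\tau_3\cap\tau_4\cap\tau_7=\tau_4\cap\tau_5\cap\tau_6=\varnothing$; (ii) $\tau_1,\dots,\tau_6$ with $\tau_1\cap\tau_3=\tau_1\cap\tau_2\cap\tau_4=\tau_1\cap\tau_2\cap\tau_5=\tau_1\cap\tau_4\cap\tau_6=\tau_1\cap\tau_5\cap\tau_6=\tau_2\cap\tau_3\cap\tau_6=\tau_3\cap\tau_4\cap\tau_5=\varnothing$; (iii) $\tau_1,\dots,\tau_5$ with $\tau_1\cap\tau_2=\tau_1\cap\tau_5=\tau_1\cap\tau_3\cap\tau_4=\tau_2\cap\tau_3\cap\tau_5=\tau_2\cap\tau_4\cap\tau_5=\varnothing$; (iv) $\tau_1,\dots,\tau_4$ with $\tau_1\cap(\tau_2\cup\tau_3\cup\tau_4)=\tau_2\cap\tau_3\cap\tau_4=\varnothing$; (v) $\tau_1,\tau_2,\tau_3$ with $\tau_1\cap\tau_2=\tau_1\cap\tau_3=\tau_2\cap\tau_3=\varnothing$.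 -/

import Mathlib

/-!
Conventions. A simplicial complex `K` on `m` vertices is given by Mathlib's
`PreAbstractSimplicialComplex (Fin m)`: a downward closed family of nonempty subsets of the
`m`-element set. Singletons are not required to belong to it. The empty set, which Mathlib does not
list among the faces, always counts as a simplex (see `IsSimplex`).
-/

namespace Buchstaber

variable {m : ℕ}

/-- `σ` is a simplex of `K`; the empty set always is. -/
def IsSimplex (K : PreAbstractSimplicialComplex (Fin m)) (σ : Finset (Fin m)) : Prop :=
  σ = ∅ ∨ σ ∈ K

/-- `K` is the full simplex on its `m` vertices, i.e. `K` consists of all subsets. -/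
def IsFullSimplex (K : PreAbstractSimplicialComplex (Fin m)) : Prop :=
  ∀ σ : Finset (Fin m), IsSimplex K σ

/-- The set `N(K)` of minimal non-simplices: the non-simplices all of whose proper subsets are
simplices. -/
def minNonSimplices (K : PreAbstractSimplicialComplex (Fin m)) : Set (Finset (Fin m)) :=
  {ω | ¬ IsSimplex K ω ∧ ∀ σ, σ ⊂ ω → IsSimplex K σ}

open Classical in
/-- The `K`-power `(X, A)^K` of a pair of sets `A ⊆ X`: the points of `X^m` for which the set of
coordinates outside `A` is a simplex of `K`. -/
def kPower {E : Type*} (K : PreAbstractSimplicialComplex (Fin m)) (X A : Set E) :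
    Set (Fin m → E) :=
  {x | (∀ i, x i ∈ X) ∧ IsSimplex K (Finset.univ.filter fun i => x i ∉ A)}

/-- The moment-angle complex `(D², S¹)^K`, as a subset of `ℂ^m`. -/
def momentAngleComplex (K : PreAbstractSimplicialComplex (Fin m)) : Set (Fin m → ℂ) :=
  kPower K (Metric.closedBall (0 : ℂ) 1) (Metric.sphere (0 : ℂ) 1)

/-- The subgroup `H` of the torus `T^m` acts freely on the moment-angle complex by coordinatewise
multiplication: only the identity of `H` fixes a point. -/
def ActsFreely (K : PreAbstractSimplicialComplex (Fin m)) (H : Subgroup (Fin m → Circle)) : Prop :=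
  ∀ t ∈ H, ∀ z ∈ momentAngleComplex K, (fun i => (t i : ℂ) * z i) = z → t = 1

/-- The dimensions `s` of toric subgroups of `T^m` (subgroups isomorphic to the torus `T^s` as
topological groups) that act freely on the moment-angle complex. -/
def freeToricDims (K : PreAbstractSimplicialComplex (Fin m)) : Set ℕ :=
  {s | ∃ H : Subgroup (Fin m → Circle), Nonempty (H ≃ₜ* (Fin s → Circle)) ∧ ActsFreely K H}

/-- The Buchstaber invariant `s(K)`: the maximal dimension of a toric subgroup of `T^m` that acts
freely on the moment-angle complex. The maximum exists, see `isGreatest_buchstaberInvariant`. -/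
noncomputable def buchstaberInvariant (K : PreAbstractSimplicialComplex (Fin m)) : ℕ :=
  sSup (freeToricDims K)

theorem zero_mem_freeToricDims (K : PreAbstractSimplicialComplex (Fin m)) :
    0 ∈ freeToricDims K := by
  refine ⟨⊥, ⟨{
    toFun := fun _ => 1
    invFun := fun _ => 1
    left_inv := ?_
    right_inv := ?_
    map_mul' := ?_
    continuous_toFun := continuous_const
    continuous_invFun := continuous_const }⟩, ?_⟩
  · intro x
    exact Subsingleton.elim _ _
  · intro x
    exact Subsingleton.elim _ _
  · intro x y
    exact Subsingleton.elim _ _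
  · intro t ht z _ _
    exact Subgroup.mem_bot.mp ht

/-- A subgroup of `T^m` isomorphic to `T^s` has `s ≤ m`: count the elements of order two. -/
theorem le_of_mem_freeToricDims {K : PreAbstractSimplicialComplex (Fin m)} {s : ℕ}
    (hs : s ∈ freeToricDims K) : s ≤ m := by
  classical
  obtain ⟨H, ⟨e⟩, -⟩ := hs
  obtain ⟨c, hc1, hc2⟩ : ∃ c : Circle, c ≠ 1 ∧ c * c = 1 := by
    refine ⟨Circle.exp Real.pi, ?_, ?_⟩
    · intro h
      have h2 := congrArg (fun z : Circle => (z : ℂ)) h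
      norm_num [Circle.coe_exp, Complex.exp_pi_mul_I] at h2
    · ext
      simp [Circle.coe_exp, Complex.exp_pi_mul_I]
  let x : (Fin s → Bool) → (Fin s → Circle) := fun b i => if b i then c else 1
  have hx : ∀ b, x b * x b = 1 := by
    intro b
    funext i
    by_cases h : b i <;> simp [x, h, hc2]
  let y : (Fin s → Bool) → (Fin m → Circle) := fun b => (e.symm (x b) : H)
  have hy : ∀ b, y b * y b = 1 := by
    intro b
    have h : e.symm (x b) * e.symm (x b) = 1 := by
      rw [← map_mul, hx, map_one]
    exact congrArg Subtype.val h
  have hpm : ∀ b i, (y b i : ℂ) = 1 ∨ (y b i : ℂ) = -1 := by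
    intro b i
    have h := congrArg (fun z : Circle => (z : ℂ)) (congrFun (hy b) i)
    simp only [Pi.mul_apply, Pi.one_apply, Circle.coe_mul, Circle.coe_one] at h
    exact mul_self_eq_one_iff.mp h
  have hinj : Function.Injective fun b : Fin s → Bool => fun i : Fin m => decide (y b i = 1) := by
    intro b b' h
    have hyy : y b = y b' := by
      funext i
      have hi := congrFun h i
      simp only [decide_eq_decide] at hi
      by_cases h1 : y b i = 1
      · rw [h1, hi.mp h1]
      · have h1' : ¬ y b' i = 1 := fun h' => h1 (hi.mpr h')
        ext
        rcases hpm b i with h2 | h2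
        · exact absurd (Circle.ext (by simpa using h2)) h1
        · rcases hpm b' i with h3 | h3
          · exact absurd (Circle.ext (by simpa using h3)) h1'
          · rw [h2, h3]
    have hxx : x b = x b' := e.symm.injective (Subtype.ext hyy)
    funext i
    have hi := congrFun hxx i
    by_cases h1 : b i <;> by_cases h2 : b' i <;> simp_all [x]
  have hcard := Fintype.card_le_of_injective _ hinj
  simp only [Fintype.card_fun, Fintype.card_bool, Fintype.card_fin] at hcard
  exact (Nat.pow_le_pow_iff_right (by norm_num)).mp hcard

/-- The Buchstaber invariant is attained and maximal. -/
theorem isGreatest_buchstaberInvariant (K : PreAbstractSimplicialComplex (Fin m)) :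
    IsGreatest (freeToricDims K) (buchstaberInvariant K) := by
  have hb : BddAbove (freeToricDims K) := ⟨m, fun _ hs => le_of_mem_freeToricDims hs⟩
  exact ⟨Nat.sSup_mem ⟨0, zero_mem_freeToricDims K⟩ hb, fun _ hs => le_csSup hb hs⟩

/-- `N` contains two, or three, distinct sets with empty intersection. -/
def HasDisjointPairOrTriple (N : Set (Finset (Fin m))) : Prop :=
  (∃ τ₁ ∈ N, ∃ τ₂ ∈ N, [τ₁, τ₂].Nodup ∧ τ₁ ∩ τ₂ = ∅) ∨
  (∃ τ₁ ∈ N, ∃ τ₂ ∈ N, ∃ τ₃ ∈ N, [τ₁, τ₂, τ₃].Nodup ∧ τ₁ ∩ τ₂ ∩ τ₃ = ∅)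

/-- First configuration: seven distinct sets. -/
def ConfigOne (N : Set (Finset (Fin m))) : Prop :=
  ∃ τ₁ ∈ N, ∃ τ₂ ∈ N, ∃ τ₃ ∈ N, ∃ τ₄ ∈ N, ∃ τ₅ ∈ N, ∃ τ₆ ∈ N, ∃ τ₇ ∈ N,
    [τ₁, τ₂, τ₃, τ₄, τ₅, τ₆, τ₇].Nodup ∧
    τ₁ ∩ τ₂ ∩ τ₄ = ∅ ∧ τ₁ ∩ τ₃ ∩ τ₅ = ∅ ∧ τ₁ ∩ τ₆ ∩ τ₇ = ∅ ∧ τ₂ ∩ τ₃ ∩ τ₆ = ∅ ∧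
    τ₂ ∩ τ₅ ∩ τ₇ = ∅ ∧ τ₃ ∩ τ₄ ∩ τ₇ = ∅ ∧ τ₄ ∩ τ₅ ∩ τ₆ = ∅

/-- Second configuration: six distinct sets. -/
def ConfigTwo (N : Set (Finset (Fin m))) : Prop :=
  ∃ τ₁ ∈ N, ∃ τ₂ ∈ N, ∃ τ₃ ∈ N, ∃ τ₄ ∈ N, ∃ τ₅ ∈ N, ∃ τ₆ ∈ N,
    [τ₁, τ₂, τ₃, τ₄, τ₅, τ₆].Nodup ∧
    τ₁ ∩ τ₃ = ∅ ∧ τ₁ ∩ τ₂ ∩ τ₄ = ∅ ∧ τ₁ ∩ τ₂ ∩ τ₅ = ∅ ∧ τ₁ ∩ τ₄ ∩ τ₆ = ∅ ∧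
    τ₁ ∩ τ₅ ∩ τ₆ = ∅ ∧ τ₂ ∩ τ₃ ∩ τ₆ = ∅ ∧ τ₃ ∩ τ₄ ∩ τ₅ = ∅

/-- Third configuration: five distinct sets. -/
def ConfigThree (N : Set (Finset (Fin m))) : Prop :=
  ∃ τ₁ ∈ N, ∃ τ₂ ∈ N, ∃ τ₃ ∈ N, ∃ τ₄ ∈ N, ∃ τ₅ ∈ N,
    [τ₁, τ₂, τ₃, τ₄, τ₅].Nodup ∧
    τ₁ ∩ τ₂ = ∅ ∧ τ₁ ∩ τ₅ = ∅ ∧ τ₁ ∩ τ₃ ∩ τ₄ = ∅ ∧ τ₂ ∩ τ₃ ∩ τ₅ = ∅ ∧ τ₂ ∩ τ₄ ∩ τ₅ = ∅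

/-- Fourth configuration: four distinct sets. -/
def ConfigFour (N : Set (Finset (Fin m))) : Prop :=
  ∃ τ₁ ∈ N, ∃ τ₂ ∈ N, ∃ τ₃ ∈ N, ∃ τ₄ ∈ N,
    [τ₁, τ₂, τ₃, τ₄].Nodup ∧ τ₁ ∩ (τ₂ ∪ τ₃ ∪ τ₄) = ∅ ∧ τ₂ ∩ τ₃ ∩ τ₄ = ∅

/-- Fifth configuration: three distinct, pairwise disjoint sets. -/
def ConfigFive (N : Set (Finset (Fin m))) : Prop :=
  ∃ τ₁ ∈ N, ∃ τ₂ ∈ N, ∃ τ₃ ∈ N,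
    [τ₁, τ₂, τ₃].Nodup ∧ τ₁ ∩ τ₂ = ∅ ∧ τ₁ ∩ τ₃ = ∅ ∧ τ₂ ∩ τ₃ = ∅

end Buchstaber

namespace Buchstaber

variable {m : ℕ}

/-! For r = 1, 2, 3 the bound s(K) ≥ r holds exactly when there are minimal non-simplices τ_b,
repetitions allowed, indexed by the nonzero b in F₂^r, with τ_b ∩ τ_b' ∩ τ_(b+b') = ∅ for b ≠ b'.
The exact values 0, 1, 2 follow by comparing consecutive bounds.

Necessity (`exists_minNonSimplices_of_mem_freeToricDims`, valid for every r): a free torus of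
dimension at least r contains a copy of F₂^r acting by signs. The support of a nontrivial element is
not a simplex, so it contains a minimal non-simplex τ_b. No coordinate is -1 for b, b' and b+b' at
once.

Sufficiency: read each b as a linear form. For every vertex i choose a_i in F₂^r on which each b
with i ∈ τ_b takes the value 1. Such a system is inconsistent only if an odd number of its forms sum
to zero, hence only if it contains an odd circuit; in rank at most 3 this is a triple b, b', b+b',
which the empty intersections exclude. The vectors a_i, lifted to 0/1 exponents, define a
homomorphism from T^r to T^m. Off any simplex there remain vertices whose a_i lie in no hyperplane
of F₂^r, so some r of them have odd determinant; a 0/1 determinant of size at most 3 has absolute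
value at most 2, so it is ±1 and stabilisers are trivial.

For r = 3 the index set is the Fano plane and the conditions are its seven lines. The five
configurations of distinct sets are what remains of this pattern after coincidences among the seven
sets are sorted out. -/

/-! ### The Fano pattern and its degenerations -/

/-- The intersection pattern of `ConfigOne`, for sets that need not be distinct. -/
def PatternOne (τ₁ τ₂ τ₃ τ₄ τ₅ τ₆ τ₇ : Finset (Fin m)) : Prop :=
  ∀ x,
    (x ∈ τ₁ → x ∈ τ₂ → x ∉ τ₄) ∧ (x ∈ τ₁ → x ∈ τ₃ → x ∉ τ₅) ∧
    (x ∈ τ₁ → x ∈ τ₆ → x ∉ τ₇) ∧ (x ∈ τ₂ → x ∈ τ₃ → x ∉ τ₆) ∧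
    (x ∈ τ₂ → x ∈ τ₅ → x ∉ τ₇) ∧ (x ∈ τ₃ → x ∈ τ₄ → x ∉ τ₇) ∧
    (x ∈ τ₄ → x ∈ τ₅ → x ∉ τ₆)

/-- The intersection pattern of `ConfigTwo`, for sets that need not be distinct. -/
def PatternTwo (τ₁ τ₂ τ₃ τ₄ τ₅ τ₆ : Finset (Fin m)) : Prop :=
  ∀ x,
    (x ∈ τ₁ → x ∉ τ₃) ∧ (x ∈ τ₁ → x ∈ τ₂ → x ∉ τ₄) ∧
    (x ∈ τ₁ → x ∈ τ₂ → x ∉ τ₅) ∧ (x ∈ τ₁ → x ∈ τ₄ → x ∉ τ₆) ∧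
    (x ∈ τ₁ → x ∈ τ₅ → x ∉ τ₆) ∧ (x ∈ τ₂ → x ∈ τ₃ → x ∉ τ₆) ∧
    (x ∈ τ₃ → x ∈ τ₄ → x ∉ τ₅)

/-- The intersection pattern of `ConfigThree`, for sets that need not be distinct. -/
def PatternThree (τ₁ τ₂ τ₃ τ₄ τ₅ : Finset (Fin m)) : Prop :=
  ∀ x,
    (x ∈ τ₁ → x ∉ τ₂) ∧ (x ∈ τ₁ → x ∉ τ₅) ∧
    (x ∈ τ₁ → x ∈ τ₃ → x ∉ τ₄) ∧ (x ∈ τ₂ → x ∈ τ₃ → x ∉ τ₅) ∧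
    (x ∈ τ₂ → x ∈ τ₄ → x ∉ τ₅)

/-- The intersection pattern of `ConfigFour`, for sets that need not be distinct. -/
def PatternFour (τ₁ τ₂ τ₃ τ₄ : Finset (Fin m)) : Prop :=
  ∀ x,
    (x ∈ τ₁ → x ∉ τ₂) ∧ (x ∈ τ₁ → x ∉ τ₃) ∧
    (x ∈ τ₁ → x ∉ τ₄) ∧ (x ∈ τ₂ → x ∈ τ₃ → x ∉ τ₄)

/-- The intersection pattern of `ConfigFive`, for sets that need not be distinct. -/
def PatternFive (τ₁ τ₂ τ₃ : Finset (Fin m)) : Prop :=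
  ∀ x,
    (x ∈ τ₁ → x ∉ τ₂) ∧ (x ∈ τ₁ → x ∉ τ₃) ∧
    (x ∈ τ₂ → x ∉ τ₃)

theorem config_of_patternFive {N : Set (Finset (Fin m))} (hN : ∀ τ ∈ N, τ.Nonempty)
    {τ₁ τ₂ τ₃ : Finset (Fin m)}
    (h₁ : τ₁ ∈ N) (h₂ : τ₂ ∈ N) (h₃ : τ₃ ∈ N)
    (h : PatternFive τ₁ τ₂ τ₃) :
    ConfigFive N := by
  obtain ⟨x, hx⟩ := hN _ h₁
  obtain ⟨y, hy⟩ := hN _ h₂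
  have n₁₂ : τ₁ ≠ τ₂ := by
    rintro rfl
    exact (h x).1 hx hx
  have n₁₃ : τ₁ ≠ τ₃ := by
    rintro rfl
    exact (h x).2.1 hx hx
  have n₂₃ : τ₂ ≠ τ₃ := by
    rintro rfl
    exact (h y).2.2 hy hy
  refine ⟨_, h₁, _, h₂, _, h₃, by simp [*], ?_⟩
  simpa only [Finset.ext_iff, Finset.mem_inter, Finset.notMem_empty, iff_false, not_and, and_imp,
    PatternFive, forall_and] using h

/-- A coincidence with τ₁ would make a nonempty set disjoint from itself; a coincidence among the
other three turns their triple condition into a disjoint pair. -/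
theorem config_of_patternFour {N : Set (Finset (Fin m))} (hN : ∀ τ ∈ N, τ.Nonempty)
    {τ₁ τ₂ τ₃ τ₄ : Finset (Fin m)}
    (h₁ : τ₁ ∈ N) (h₂ : τ₂ ∈ N) (h₃ : τ₃ ∈ N) (h₄ : τ₄ ∈ N)
    (h : PatternFour τ₁ τ₂ τ₃ τ₄) :
    ConfigFour N ∨ ConfigFive N := by
  rcases eq_or_ne τ₁ τ₂ with rfl | n₁₂
  · obtain ⟨x, hx⟩ := hN _ h₁
    exact ((h x).1 hx hx).elim
  rcases eq_or_ne τ₁ τ₃ with rfl | n₁₃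
  · obtain ⟨x, hx⟩ := hN _ h₁
    exact ((h x).2.1 hx hx).elim
  rcases eq_or_ne τ₁ τ₄ with rfl | n₁₄
  · obtain ⟨x, hx⟩ := hN _ h₁
    exact ((h x).2.2.1 hx hx).elim
  rcases eq_or_ne τ₂ τ₃ with rfl | n₂₃
  · refine .inr (config_of_patternFive hN h₁ h₂ h₄ fun x => ?_)
    obtain ⟨c₁, c₂, c₃, c₄⟩ := h x
    exact ⟨c₁, c₃, fun hx hy => c₄ hx hx hy⟩
  rcases eq_or_ne τ₂ τ₄ with rfl | n₂₄
  · refine .inr (config_of_patternFive hN h₁ h₂ h₃ fun x => ?_)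
    obtain ⟨c₁, c₂, c₃, c₄⟩ := h x
    exact ⟨c₁, c₂, fun hx hy => c₄ hx hy hx⟩
  rcases eq_or_ne τ₃ τ₄ with rfl | n₃₄
  · refine .inr (config_of_patternFive hN h₁ h₂ h₃ fun x => ?_)
    obtain ⟨c₁, c₂, c₃, c₄⟩ := h x
    exact ⟨c₁, c₂, fun hx hy => c₄ hx hy hy⟩
  left
  refine ⟨_, h₁, _, h₂, _, h₃, _, h₄, by simp [*], ?_⟩
  simpa only [Finset.ext_iff, Finset.mem_inter, Finset.notMem_empty, iff_false, not_and, and_imp,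
    Finset.mem_union, not_or, and_assoc, imp_and, PatternFour, forall_and] using h

theorem config_of_patternThree {N : Set (Finset (Fin m))} (hN : ∀ τ ∈ N, τ.Nonempty)
    {τ₁ τ₂ τ₃ τ₄ τ₅ : Finset (Fin m)}
    (h₁ : τ₁ ∈ N) (h₂ : τ₂ ∈ N) (h₃ : τ₃ ∈ N) (h₄ : τ₄ ∈ N) (h₅ : τ₅ ∈ N)
    (h : PatternThree τ₁ τ₂ τ₃ τ₄ τ₅) :
    ConfigThree N ∨ ConfigFour N ∨ ConfigFive N := by
  rcases eq_or_ne τ₁ τ₂ with rfl | n₁₂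
  · obtain ⟨x, hx⟩ := hN _ h₁
    exact ((h x).1 hx hx).elim
  rcases eq_or_ne τ₁ τ₃ with rfl | n₁₃
  · refine .inr (config_of_patternFour hN h₁ h₂ h₄ h₅ fun x => ?_)
    obtain ⟨c₁, c₂, c₃, c₄, c₅⟩ := h x
    exact ⟨c₁, fun hx hy => c₃ hx hx hy, c₂, c₅⟩
  rcases eq_or_ne τ₁ τ₄ with rfl | n₁₄
  · refine .inr (config_of_patternFour hN h₁ h₂ h₃ h₅ fun x => ?_)
    obtain ⟨c₁, c₂, c₃, c₄, c₅⟩ := h x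
    exact ⟨c₁, fun hx hy => c₃ hx hy hx, c₂, c₄⟩
  rcases eq_or_ne τ₁ τ₅ with rfl | n₁₅
  · obtain ⟨x, hx⟩ := hN _ h₁
    exact ((h x).2.1 hx hx).elim
  rcases eq_or_ne τ₂ τ₃ with rfl | n₂₃
  · refine .inr (config_of_patternFour hN h₁ h₂ h₂ h₅ fun x => ?_)
    obtain ⟨c₁, c₂, c₃, c₄, c₅⟩ := h x
    exact ⟨c₁, c₁, c₂, c₄⟩
  rcases eq_or_ne τ₂ τ₄ with rfl | n₂₄
  · refine .inr (config_of_patternFour hN h₁ h₂ h₂ h₅ fun x => ?_)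
    obtain ⟨c₁, c₂, c₃, c₄, c₅⟩ := h x
    exact ⟨c₁, c₁, c₂, c₅⟩
  rcases eq_or_ne τ₂ τ₅ with rfl | n₂₅
  · refine .inr (config_of_patternFour hN h₂ h₁ h₃ h₄ fun x => ?_)
    obtain ⟨c₁, c₂, c₃, c₄, c₅⟩ := h x
    exact ⟨fun hx hy => c₁ hy hx, fun hx hy => c₄ hx hy hx, fun hx hy => c₅ hx hy hx, c₃⟩
  rcases eq_or_ne τ₃ τ₄ with rfl | n₃₄
  · refine .inr (config_of_patternFour hN h₁ h₂ h₃ h₅ fun x => ?_)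
    obtain ⟨c₁, c₂, c₃, c₄, c₅⟩ := h x
    exact ⟨c₁, fun hx hy => c₃ hx hy hy, c₂, c₄⟩
  rcases eq_or_ne τ₃ τ₅ with rfl | n₃₅
  · refine .inr (config_of_patternFour hN h₁ h₂ h₂ h₃ fun x => ?_)
    obtain ⟨c₁, c₂, c₃, c₄, c₅⟩ := h x
    exact ⟨c₁, c₁, c₂, fun hx _ hz => c₄ hx hz hz⟩
  rcases eq_or_ne τ₄ τ₅ with rfl | n₄₅
  · refine .inr (config_of_patternFour hN h₁ h₂ h₂ h₄ fun x => ?_)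
    obtain ⟨c₁, c₂, c₃, c₄, c₅⟩ := h x
    exact ⟨c₁, c₁, c₂, fun hx _ hz => c₅ hx hz hz⟩
  left
  refine ⟨_, h₁, _, h₂, _, h₃, _, h₄, _, h₅, by simp [*], ?_⟩
  simpa only [Finset.ext_iff, Finset.mem_inter, Finset.notMem_empty, iff_false, not_and, and_imp,
    PatternThree, forall_and] using h

/-- Only τ₁ = τ₃ is contradictory. Every other coincidence degenerates to `PatternThree`, sometimes
with a repeated argument, which the smaller lemma then resolves. -/
theorem config_of_patternTwo {N : Set (Finset (Fin m))} (hN : ∀ τ ∈ N, τ.Nonempty)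
    {τ₁ τ₂ τ₃ τ₄ τ₅ τ₆ : Finset (Fin m)}
    (h₁ : τ₁ ∈ N) (h₂ : τ₂ ∈ N) (h₃ : τ₃ ∈ N) (h₄ : τ₄ ∈ N)
    (h₅ : τ₅ ∈ N) (h₆ : τ₆ ∈ N)
    (h : PatternTwo τ₁ τ₂ τ₃ τ₄ τ₅ τ₆) :
    ConfigTwo N ∨ ConfigThree N ∨ ConfigFour N ∨ ConfigFive N := by
  rcases eq_or_ne τ₁ τ₂ with rfl | n₁₂
  · refine .inr (config_of_patternThree hN h₁ h₃ h₁ h₄ h₅ fun x => ?_)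
    obtain ⟨c₁, c₂, c₃, c₄, c₅, c₆, c₇⟩ := h x
    exact ⟨c₁, fun hx hy => c₃ hx hx hy, c₂, fun hx hy _ => c₁ hy hx, c₇⟩
  rcases eq_or_ne τ₁ τ₃ with rfl | n₁₃
  · obtain ⟨x, hx⟩ := hN _ h₁
    exact ((h x).1 hx hx).elim
  rcases eq_or_ne τ₁ τ₄ with rfl | n₁₄
  · refine .inr (config_of_patternThree hN h₁ h₂ h₁ h₃ h₆ fun x => ?_)
    obtain ⟨c₁, c₂, c₃, c₄, c₅, c₆, c₇⟩ := h x
    exact ⟨fun hx hy => c₂ hx hy hx, fun hx hy => c₄ hx hx hy, fun hx _ hz => c₁ hx hz,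
      fun hx hy _ => c₂ hy hx hy, c₆⟩
  rcases eq_or_ne τ₁ τ₅ with rfl | n₁₅
  · refine .inr (config_of_patternThree hN h₁ h₂ h₁ h₃ h₆ fun x => ?_)
    obtain ⟨c₁, c₂, c₃, c₄, c₅, c₆, c₇⟩ := h x
    exact ⟨fun hx hy => c₃ hx hy hx, fun hx hy => c₅ hx hx hy, fun hx _ hz => c₁ hx hz,
      fun hx hy _ => c₃ hy hx hy, c₆⟩
  rcases eq_or_ne τ₁ τ₆ with rfl | n₁₆
  · refine .inr (config_of_patternThree hN h₁ h₃ h₁ h₄ h₅ fun x => ?_)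
    obtain ⟨c₁, c₂, c₃, c₄, c₅, c₆, c₇⟩ := h x
    exact ⟨c₁, fun hx hy => c₅ hx hy hx, fun hx _ hz => c₄ hx hz hx, fun hx hy _ => c₁ hy hx, c₇⟩
  rcases eq_or_ne τ₂ τ₃ with rfl | n₂₃
  · refine .inr (config_of_patternThree hN h₂ h₁ h₄ h₅ h₆ fun x => ?_)
    obtain ⟨c₁, c₂, c₃, c₄, c₅, c₆, c₇⟩ := h x
    exact ⟨fun hx hy => c₁ hy hx, fun hx hy => c₆ hx hx hy, c₇, c₄, c₅⟩
  rcases eq_or_ne τ₂ τ₄ with rfl | n₂₄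
  · refine .inr (config_of_patternThree hN h₁ h₂ h₅ h₆ h₃ fun x => ?_)
    obtain ⟨c₁, c₂, c₃, c₄, c₅, c₆, c₇⟩ := h x
    exact ⟨fun hx hy => c₂ hx hy hy, c₁, c₅, fun hx hy hz => c₇ hz hx hy,
      fun hx hy hz => c₆ hx hz hy⟩
  rcases eq_or_ne τ₂ τ₅ with rfl | n₂₅
  · refine .inr (config_of_patternThree hN h₁ h₂ h₄ h₆ h₃ fun x => ?_)
    obtain ⟨c₁, c₂, c₃, c₄, c₅, c₆, c₇⟩ := h x
    exact ⟨fun hx hy => c₃ hx hy hy, c₁, c₄, fun hx hy hz => c₇ hz hy hx,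
      fun hx hy hz => c₆ hx hz hy⟩
  rcases eq_or_ne τ₂ τ₆ with rfl | n₂₆
  · refine .inr (config_of_patternThree hN h₃ h₁ h₄ h₅ h₂ fun x => ?_)
    obtain ⟨c₁, c₂, c₃, c₄, c₅, c₆, c₇⟩ := h x
    exact ⟨fun hx hy => c₁ hy hx, fun hx hy => c₆ hy hx hy, c₇, fun hx hy hz => c₂ hx hz hy,
      fun hx hy hz => c₃ hx hz hy⟩
  rcases eq_or_ne τ₃ τ₄ with rfl | n₃₄
  · refine .inr (config_of_patternThree hN h₃ h₁ h₂ h₆ h₅ fun x => ?_)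
    obtain ⟨c₁, c₂, c₃, c₄, c₅, c₆, c₇⟩ := h x
    exact ⟨fun hx hy => c₁ hy hx, fun hx hy => c₇ hx hx hy, fun hx hy hz => c₆ hy hx hz, c₃,
      fun hx hy hz => c₅ hx hz hy⟩
  rcases eq_or_ne τ₃ τ₅ with rfl | n₃₅
  · refine .inr (config_of_patternThree hN h₃ h₁ h₂ h₆ h₄ fun x => ?_)
    obtain ⟨c₁, c₂, c₃, c₄, c₅, c₆, c₇⟩ := h x
    exact ⟨fun hx hy => c₁ hy hx, fun hx hy => c₇ hx hy hx, fun hx hy hz => c₆ hy hx hz, c₂,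
      fun hx hy hz => c₄ hx hz hy⟩
  rcases eq_or_ne τ₃ τ₆ with rfl | n₃₆
  · refine .inr (config_of_patternThree hN h₃ h₁ h₄ h₅ h₂ fun x => ?_)
    obtain ⟨c₁, c₂, c₃, c₄, c₅, c₆, c₇⟩ := h x
    exact ⟨fun hx hy => c₁ hy hx, fun hx hy => c₆ hy hx hx, c₇, fun hx hy hz => c₂ hx hz hy,
      fun hx hy hz => c₃ hx hz hy⟩
  rcases eq_or_ne τ₄ τ₅ with rfl | n₄₅
  · refine .inr (config_of_patternThree hN h₃ h₁ h₂ h₆ h₄ fun x => ?_)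
    obtain ⟨c₁, c₂, c₃, c₄, c₅, c₆, c₇⟩ := h x
    exact ⟨fun hx hy => c₁ hy hx, fun hx hy => c₇ hx hy hy, fun hx hy hz => c₆ hy hx hz, c₂,
      fun hx hy hz => c₄ hx hz hy⟩
  rcases eq_or_ne τ₄ τ₆ with rfl | n₄₆
  · refine .inr (config_of_patternThree hN h₁ h₃ h₂ h₅ h₄ fun x => ?_)
    obtain ⟨c₁, c₂, c₃, c₄, c₅, c₆, c₇⟩ := h x
    exact ⟨c₁, fun hx hy => c₄ hx hy hy, c₃, fun hx hy hz => c₆ hy hx hz,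
      fun hx hy hz => c₇ hx hz hy⟩
  rcases eq_or_ne τ₅ τ₆ with rfl | n₅₆
  · refine .inr (config_of_patternThree hN h₁ h₃ h₂ h₄ h₅ fun x => ?_)
    obtain ⟨c₁, c₂, c₃, c₄, c₅, c₆, c₇⟩ := h x
    exact ⟨c₁, fun hx hy => c₅ hx hy hy, c₂, fun hx hy hz => c₆ hy hx hz, c₇⟩
  left
  refine ⟨_, h₁, _, h₂, _, h₃, _, h₄, _, h₅, _, h₆, by simp [*], ?_⟩
  simpa only [Finset.ext_iff, Finset.mem_inter, Finset.notMem_empty, iff_false, not_and, and_imp,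
    PatternTwo, forall_and] using h

/-- Collineations act 2-transitively on the points of the Fano plane, so all 21 coincidences give
the same pattern `PatternTwo` up to relabelling. -/
theorem config_of_patternOne {N : Set (Finset (Fin m))} (hN : ∀ τ ∈ N, τ.Nonempty)
    {τ₁ τ₂ τ₃ τ₄ τ₅ τ₆ τ₇ : Finset (Fin m)}
    (h₁ : τ₁ ∈ N) (h₂ : τ₂ ∈ N) (h₃ : τ₃ ∈ N) (h₄ : τ₄ ∈ N)
    (h₅ : τ₅ ∈ N) (h₆ : τ₆ ∈ N) (h₇ : τ₇ ∈ N)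
    (h : PatternOne τ₁ τ₂ τ₃ τ₄ τ₅ τ₆ τ₇) :
    ConfigOne N ∨ ConfigTwo N ∨ ConfigThree N ∨ ConfigFour N ∨ ConfigFive N := by
  rcases eq_or_ne τ₁ τ₂ with rfl | n₁₂
  · refine .inr (config_of_patternTwo hN h₁ h₃ h₄ h₅ h₆ h₇ fun x => ?_)
    obtain ⟨c₁, c₂, c₃, c₄, c₅, c₆, c₇⟩ := h x
    exact ⟨fun hx hy => c₁ hx hx hy, c₂, c₄, c₅, c₃, c₆, c₇⟩
  rcases eq_or_ne τ₁ τ₃ with rfl | n₁₃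
  · refine .inr (config_of_patternTwo hN h₁ h₂ h₅ h₄ h₆ h₇ fun x => ?_)
    obtain ⟨c₁, c₂, c₃, c₄, c₅, c₆, c₇⟩ := h x
    exact ⟨fun hx hy => c₂ hx hx hy, c₁, fun hx hy hz => c₄ hy hx hz, c₆, c₃, c₅,
      fun hx hy hz => c₇ hy hx hz⟩
  rcases eq_or_ne τ₁ τ₄ with rfl | n₁₄
  · refine .inr (config_of_patternTwo hN h₁ h₃ h₂ h₅ h₇ h₆ fun x => ?_)
    obtain ⟨c₁, c₂, c₃, c₄, c₅, c₆, c₇⟩ := h x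
    exact ⟨fun hx hy => c₁ hx hy hx, c₂, fun hx hy hz => c₆ hy hx hz, c₇,
      fun hx hy hz => c₃ hx hz hy, fun hx hy hz => c₄ hy hx hz, c₅⟩
  rcases eq_or_ne τ₁ τ₅ with rfl | n₁₅
  · refine .inr (config_of_patternTwo hN h₁ h₂ h₃ h₄ h₇ h₆ fun x => ?_)
    obtain ⟨c₁, c₂, c₃, c₄, c₅, c₆, c₇⟩ := h x
    exact ⟨fun hx hy => c₂ hx hy hx, c₁, fun hx hy hz => c₅ hy hx hz, fun hx hy hz => c₇ hy hx hz,
      fun hx hy hz => c₃ hx hz hy, c₄, c₆⟩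
  rcases eq_or_ne τ₁ τ₆ with rfl | n₁₆
  · refine .inr (config_of_patternTwo hN h₁ h₂ h₇ h₃ h₄ h₅ fun x => ?_)
    obtain ⟨c₁, c₂, c₃, c₄, c₅, c₆, c₇⟩ := h x
    exact ⟨fun hx hy => c₃ hx hx hy, fun hx hy hz => c₄ hy hz hx, c₁, c₂,
      fun hx hy hz => c₇ hy hz hx, fun hx hy hz => c₅ hx hz hy, fun hx hy hz => c₆ hy hz hx⟩
  rcases eq_or_ne τ₁ τ₇ with rfl | n₁₇
  · refine .inr (config_of_patternTwo hN h₁ h₂ h₆ h₄ h₅ h₃ fun x => ?_)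
    obtain ⟨c₁, c₂, c₃, c₄, c₅, c₆, c₇⟩ := h x
    exact ⟨fun hx hy => c₃ hx hy hx, c₁, fun hx hy hz => c₅ hy hz hx, fun hx hy hz => c₆ hz hy hx,
      fun hx hy hz => c₂ hx hz hy, fun hx hy hz => c₄ hx hz hy, fun hx hy hz => c₇ hy hz hx⟩
  rcases eq_or_ne τ₂ τ₃ with rfl | n₂₃
  · refine .inr (config_of_patternTwo hN h₂ h₁ h₆ h₄ h₅ h₇ fun x => ?_)
    obtain ⟨c₁, c₂, c₃, c₄, c₅, c₆, c₇⟩ := h x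
    exact ⟨fun hx hy => c₄ hx hx hy, fun hx hy hz => c₁ hy hx hz, fun hx hy hz => c₂ hy hx hz, c₆,
      c₅, c₃, fun hx hy hz => c₇ hy hz hx⟩
  rcases eq_or_ne τ₂ τ₄ with rfl | n₂₄
  · refine .inr (config_of_patternTwo hN h₂ h₃ h₁ h₆ h₇ h₅ fun x => ?_)
    obtain ⟨c₁, c₂, c₃, c₄, c₅, c₆, c₇⟩ := h x
    exact ⟨fun hx hy => c₁ hy hx hx, c₄, fun hx hy hz => c₆ hy hx hz, fun hx hy hz => c₇ hx hz hy,
      fun hx hy hz => c₅ hx hz hy, fun hx hy hz => c₂ hy hx hz, c₃⟩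
  rcases eq_or_ne τ₂ τ₅ with rfl | n₂₅
  · refine .inr (config_of_patternTwo hN h₂ h₁ h₇ h₃ h₄ h₆ fun x => ?_)
    obtain ⟨c₁, c₂, c₃, c₄, c₅, c₆, c₇⟩ := h x
    exact ⟨fun hx hy => c₅ hx hx hy, fun hx hy hz => c₂ hy hz hx, fun hx hy hz => c₁ hy hx hz, c₄,
      fun hx hy hz => c₇ hy hx hz, fun hx hy hz => c₃ hx hz hy, fun hx hy hz => c₆ hy hz hx⟩
  rcases eq_or_ne τ₂ τ₆ with rfl | n₂₆
  · refine .inr (config_of_patternTwo hN h₂ h₁ h₃ h₄ h₇ h₅ fun x => ?_)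
    obtain ⟨c₁, c₂, c₃, c₄, c₅, c₆, c₇⟩ := h x
    exact ⟨fun hx hy => c₄ hx hy hx, fun hx hy hz => c₁ hy hx hz, fun hx hy hz => c₃ hy hx hz,
      fun hx hy hz => c₇ hy hz hx, fun hx hy hz => c₅ hx hz hy, c₂, c₆⟩
  rcases eq_or_ne τ₂ τ₇ with rfl | n₂₇
  · refine .inr (config_of_patternTwo hN h₂ h₁ h₅ h₄ h₆ h₃ fun x => ?_)
    obtain ⟨c₁, c₂, c₃, c₄, c₅, c₆, c₇⟩ := h x
    exact ⟨fun hx hy => c₅ hx hy hx, fun hx hy hz => c₁ hy hx hz, fun hx hy hz => c₃ hy hz hx,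
      fun hx hy hz => c₆ hz hy hx, fun hx hy hz => c₄ hx hz hy, fun hx hy hz => c₂ hx hz hy,
      fun hx hy hz => c₇ hy hx hz⟩
  rcases eq_or_ne τ₃ τ₄ with rfl | n₃₄
  · refine .inr (config_of_patternTwo hN h₃ h₁ h₇ h₂ h₅ h₆ fun x => ?_)
    obtain ⟨c₁, c₂, c₃, c₄, c₅, c₆, c₇⟩ := h x
    exact ⟨fun hx hy => c₆ hx hx hy, fun hx hy hz => c₁ hy hz hx, fun hx hy hz => c₂ hy hx hz,
      fun hx hy hz => c₄ hy hx hz, c₇, fun hx hy hz => c₃ hx hz hy, fun hx hy hz => c₅ hy hz hx⟩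
  rcases eq_or_ne τ₃ τ₅ with rfl | n₃₅
  · refine .inr (config_of_patternTwo hN h₃ h₂ h₁ h₆ h₇ h₄ fun x => ?_)
    obtain ⟨c₁, c₂, c₃, c₄, c₅, c₆, c₇⟩ := h x
    exact ⟨fun hx hy => c₂ hy hx hx, fun hx hy hz => c₄ hy hx hz, fun hx hy hz => c₅ hy hx hz,
      fun hx hy hz => c₇ hz hx hy, fun hx hy hz => c₆ hx hz hy, fun hx hy hz => c₁ hy hx hz, c₃⟩
  rcases eq_or_ne τ₃ τ₆ with rfl | n₃₆
  · refine .inr (config_of_patternTwo hN h₃ h₁ h₂ h₅ h₇ h₄ fun x => ?_)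
    obtain ⟨c₁, c₂, c₃, c₄, c₅, c₆, c₇⟩ := h x
    exact ⟨fun hx hy => c₄ hy hx hx, fun hx hy hz => c₂ hy hx hz, fun hx hy hz => c₃ hy hx hz,
      fun hx hy hz => c₇ hz hy hx, fun hx hy hz => c₆ hx hz hy, c₁, c₅⟩
  rcases eq_or_ne τ₃ τ₇ with rfl | n₃₇
  · refine .inr (config_of_patternTwo hN h₃ h₁ h₄ h₅ h₆ h₂ fun x => ?_)
    obtain ⟨c₁, c₂, c₃, c₄, c₅, c₆, c₇⟩ := h x
    exact ⟨fun hx hy => c₆ hx hy hx, fun hx hy hz => c₂ hy hx hz, fun hx hy hz => c₃ hy hz hx,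
      fun hx hy hz => c₅ hz hy hx, fun hx hy hz => c₄ hz hx hy, fun hx hy hz => c₁ hx hz hy, c₇⟩
  rcases eq_or_ne τ₄ τ₅ with rfl | n₄₅
  · refine .inr (config_of_patternTwo hN h₄ h₁ h₆ h₂ h₃ h₇ fun x => ?_)
    obtain ⟨c₁, c₂, c₃, c₄, c₅, c₆, c₇⟩ := h x
    exact ⟨fun hx hy => c₇ hx hx hy, fun hx hy hz => c₁ hy hz hx, fun hx hy hz => c₂ hy hz hx,
      fun hx hy hz => c₅ hy hx hz, fun hx hy hz => c₆ hy hx hz, c₃, fun hx hy hz => c₄ hy hz hx⟩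
  rcases eq_or_ne τ₄ τ₆ with rfl | n₄₆
  · refine .inr (config_of_patternTwo hN h₄ h₁ h₅ h₂ h₇ h₃ fun x => ?_)
    obtain ⟨c₁, c₂, c₃, c₄, c₅, c₆, c₇⟩ := h x
    exact ⟨fun hx hy => c₇ hx hy hx, fun hx hy hz => c₁ hy hz hx, fun hx hy hz => c₃ hy hx hz,
      fun hx hy hz => c₄ hy hz hx, fun hx hy hz => c₆ hz hx hy, fun hx hy hz => c₂ hx hz hy,
      fun hx hy hz => c₅ hy hx hz⟩
  rcases eq_or_ne τ₄ τ₇ with rfl | n₄₇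
  · refine .inr (config_of_patternTwo hN h₄ h₁ h₃ h₂ h₆ h₅ fun x => ?_)
    obtain ⟨c₁, c₂, c₃, c₄, c₅, c₆, c₇⟩ := h x
    exact ⟨fun hx hy => c₆ hy hx hx, fun hx hy hz => c₁ hy hz hx, fun hx hy hz => c₃ hy hz hx,
      fun hx hy hz => c₅ hy hz hx, fun hx hy hz => c₇ hx hz hy, c₂, fun hx hy hz => c₄ hy hx hz⟩
  rcases eq_or_ne τ₅ τ₆ with rfl | n₅₆
  · refine .inr (config_of_patternTwo hN h₅ h₁ h₄ h₃ h₇ h₂ fun x => ?_)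
    obtain ⟨c₁, c₂, c₃, c₄, c₅, c₆, c₇⟩ := h x
    exact ⟨fun hx hy => c₇ hy hx hx, fun hx hy hz => c₂ hy hz hx, fun hx hy hz => c₃ hy hx hz,
      fun hx hy hz => c₄ hz hy hx, fun hx hy hz => c₅ hz hx hy, fun hx hy hz => c₁ hx hz hy,
      fun hx hy hz => c₆ hy hx hz⟩
  rcases eq_or_ne τ₅ τ₇ with rfl | n₅₇
  · refine .inr (config_of_patternTwo hN h₅ h₁ h₂ h₃ h₆ h₄ fun x => ?_)
    obtain ⟨c₁, c₂, c₃, c₄, c₅, c₆, c₇⟩ := h x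
    exact ⟨fun hx hy => c₅ hy hx hx, fun hx hy hz => c₂ hy hz hx, fun hx hy hz => c₃ hy hz hx,
      fun hx hy hz => c₆ hy hz hx, fun hx hy hz => c₇ hz hx hy, c₁, c₄⟩
  rcases eq_or_ne τ₆ τ₇ with rfl | n₆₇
  · refine .inr (config_of_patternTwo hN h₆ h₂ h₁ h₃ h₅ h₄ fun x => ?_)
    obtain ⟨c₁, c₂, c₃, c₄, c₅, c₆, c₇⟩ := h x
    exact ⟨fun hx hy => c₃ hy hx hx, fun hx hy hz => c₄ hy hz hx, fun hx hy hz => c₅ hy hz hx,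
      fun hx hy hz => c₆ hy hz hx, fun hx hy hz => c₇ hz hy hx, fun hx hy hz => c₁ hy hx hz, c₂⟩
  left
  refine ⟨_, h₁, _, h₂, _, h₃, _, h₄, _, h₅, _, h₆, _, h₇, by simp [*], ?_⟩
  simpa only [Finset.ext_iff, Finset.mem_inter, Finset.notMem_empty, iff_false, not_and, and_imp,
    PatternOne, forall_and] using h

theorem exists_patternOne {N : Set (Finset (Fin m))}
    (h : ConfigOne N ∨ ConfigTwo N ∨ ConfigThree N ∨ ConfigFour N ∨ ConfigFive N) :
    ∃ τ₁ ∈ N, ∃ τ₂ ∈ N, ∃ τ₃ ∈ N, ∃ τ₄ ∈ N, ∃ τ₅ ∈ N, ∃ τ₆ ∈ N, ∃ τ₇ ∈ N,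
      PatternOne τ₁ τ₂ τ₃ τ₄ τ₅ τ₆ τ₇ := by
  rcases h with h | h | h | h | h
  · obtain ⟨τ₁, h₁, τ₂, h₂, τ₃, h₃, τ₄, h₄, τ₅, h₅, τ₆, h₆, τ₇, h₇, -, h⟩ := h
    refine ⟨τ₁, h₁, τ₂, h₂, τ₃, h₃, τ₄, h₄, τ₅, h₅, τ₆, h₆, τ₇, h₇, fun x => ?_⟩
    simp only [Finset.ext_iff, Finset.mem_inter, Finset.notMem_empty, iff_false] at h
    grind
  · obtain ⟨τ₁, h₁, τ₂, h₂, τ₃, h₃, τ₄, h₄, τ₅, h₅, τ₆, h₆, -, h⟩ := h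
    refine ⟨τ₁, h₁, τ₁, h₁, τ₂, h₂, τ₃, h₃, τ₄, h₄, τ₅, h₅, τ₆, h₆, fun x => ?_⟩
    simp only [Finset.ext_iff, Finset.mem_inter, Finset.notMem_empty, iff_false] at h
    grind
  · obtain ⟨τ₁, h₁, τ₂, h₂, τ₃, h₃, τ₄, h₄, τ₅, h₅, -, h⟩ := h
    refine ⟨τ₁, h₁, τ₁, h₁, τ₂, h₂, τ₅, h₅, τ₂, h₂, τ₃, h₃, τ₄, h₄, fun x => ?_⟩
    simp only [Finset.ext_iff, Finset.mem_inter, Finset.notMem_empty, iff_false] at h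
    grind
  · obtain ⟨τ₁, h₁, τ₂, h₂, τ₃, h₃, τ₄, h₄, -, h⟩ := h
    refine ⟨τ₁, h₁, τ₁, h₁, τ₁, h₁, τ₂, h₂, τ₃, h₃, τ₄, h₄, τ₁, h₁, fun x => ?_⟩
    simp only [Finset.ext_iff, Finset.mem_inter, Finset.mem_union, Finset.notMem_empty,
      iff_false] at h
    grind
  · obtain ⟨τ₁, h₁, τ₂, h₂, τ₃, h₃, -, h⟩ := h
    refine ⟨τ₁, h₁, τ₁, h₁, τ₁, h₁, τ₂, h₂, τ₂, h₂, τ₃, h₃, τ₁, h₁, fun x => ?_⟩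
    simp only [Finset.ext_iff, Finset.mem_inter, Finset.notMem_empty, iff_false] at h
    grind

/-- Nonemptiness makes distinctness harmless: two equal sets in an empty triple intersection leave a
disjoint, hence distinct, pair. -/
theorem hasDisjointPairOrTriple_iff {N : Set (Finset (Fin m))} (hN : ∀ τ ∈ N, τ.Nonempty) :
    HasDisjointPairOrTriple N ↔ ∃ τ₁ ∈ N, ∃ τ₂ ∈ N, ∃ τ₃ ∈ N, τ₁ ∩ τ₂ ∩ τ₃ = ∅ := by
  constructor
  · rintro (⟨τ₁, h₁, τ₂, h₂, -, h⟩ | ⟨τ₁, h₁, τ₂, h₂, τ₃, h₃, -, h⟩)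
    · exact ⟨τ₁, h₁, τ₂, h₂, τ₂, h₂, by simp [h]⟩
    · exact ⟨τ₁, h₁, τ₂, h₂, τ₃, h₃, h⟩
  · rintro ⟨τ₁, h₁, τ₂, h₂, τ₃, h₃, h⟩
    have pair : ∀ {σ τ}, σ ∈ N → τ ∈ N → σ ∩ τ = ∅ → HasDisjointPairOrTriple N := by
      intro σ τ hσ hτ hστ
      refine .inl ⟨σ, hσ, τ, hτ, ?_, hστ⟩
      rcases eq_or_ne σ τ with rfl | hne
      · exact absurd (by simpa using hστ) (hN σ hσ).ne_empty
      · simpa using hne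
    rcases eq_or_ne τ₁ τ₂ with rfl | n₁₂
    · exact pair h₁ h₃ (by simpa using h)
    rcases eq_or_ne τ₁ τ₃ with rfl | n₁₃
    · rw [Finset.inter_right_comm] at h
      exact pair h₁ h₂ (by simpa using h)
    rcases eq_or_ne τ₂ τ₃ with rfl | n₂₃
    · exact pair h₁ h₂ (by simpa [Finset.inter_assoc] using h)
    exact .inr ⟨τ₁, h₁, τ₂, h₂, τ₃, h₃, by simp [*], h⟩

/-! ### Simplices and minimal non-simplices -/

theorem IsSimplex.mono {K : PreAbstractSimplicialComplex (Fin m)} {σ τ : Finset (Fin m)}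
    (hτ : IsSimplex K τ) (h : σ ⊆ τ) : IsSimplex K σ := by
  rcases σ.eq_empty_or_nonempty with rfl | hσ
  · exact .inl rfl
  rcases hτ with rfl | hτ
  · exact .inl (Finset.subset_empty.mp h)
  · exact .inr ((K.isRelLowerSet_faces hτ).2 h hσ)

theorem exists_minNonSimplices_subset {K : PreAbstractSimplicialComplex (Fin m)}
    (ω : Finset (Fin m)) (h : ¬ IsSimplex K ω) : ∃ τ ∈ minNonSimplices K, τ ⊆ ω := by
  induction ω using Finset.strongInduction with
  | H ω ih =>
    by_cases hω : ∀ σ, σ ⊂ ω → IsSimplex K σ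
    · exact ⟨ω, ⟨h, hω⟩, subset_rfl⟩
    · push Not at hω
      obtain ⟨σ, hσ, hσK⟩ := hω
      obtain ⟨τ, hτ, hτσ⟩ := ih σ hσ hσK
      exact ⟨τ, hτ, hτσ.trans hσ.subset⟩

theorem nonempty_of_mem_minNonSimplices {K : PreAbstractSimplicialComplex (Fin m)} :
    ∀ τ ∈ minNonSimplices K, τ.Nonempty := fun _ hτ =>
  Finset.nonempty_iff_ne_empty.mpr fun h => hτ.1 (.inl h)

theorem exists_mem_notMem_of_mem_minNonSimplices {K : PreAbstractSimplicialComplex (Fin m)}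
    {σ τ : Finset (Fin m)} (hτ : τ ∈ minNonSimplices K) (hσ : IsSimplex K σ) :
    ∃ i, i ∉ σ ∧ i ∈ τ := by
  by_contra! h
  exact hτ.1 (hσ.mono fun i hi => by_contra fun hn => h i hn hi)

theorem isFullSimplex_iff_minNonSimplices_eq_empty {K : PreAbstractSimplicialComplex (Fin m)} :
    IsFullSimplex K ↔ minNonSimplices K = ∅ := by
  constructor
  · intro h
    exact Set.eq_empty_of_forall_notMem fun τ hτ => hτ.1 (h τ)
  · intro h σ
    by_contra hσ
    obtain ⟨τ, hτ, -⟩ := exists_minNonSimplices_subset σ hσ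
    simp [h] at hτ

/-! ### From free tori to minimal non-simplices -/

/-- The support of a free element of the torus is not a simplex. -/
theorem not_isSimplex_support {K : PreAbstractSimplicialComplex (Fin m)}
    {H : Subgroup (Fin m → Circle)} (hH : ActsFreely K H) {t : Fin m → Circle} (ht : t ∈ H)
    (ht1 : t ≠ 1) {ω : Finset (Fin m)} (hω : ∀ i, i ∈ ω ↔ t i ≠ 1) : ¬ IsSimplex K ω := by
  classical
  intro hK
  -- The point that is 0 on the support of `t` and 1 elsewhere is fixed by `t`; it lies in the
  -- moment-angle complex if that support is a simplex.
  refine ht1 (hH t ht (fun i => if i ∈ ω then 0 else 1) ⟨fun i => ?_, ?_⟩ ?_)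
  · by_cases h : i ∈ ω <;> simp [h]
  · convert hK using 1
    ext i
    by_cases h : i ∈ ω <;> simp [h]
  · funext i
    by_cases h : i ∈ ω
    · simp [h]
    · have : t i = 1 := by simpa using (hω i).not.mp h
      simp [h, this]

/-- The elements of order two of a free toric subgroup yield minimal non-simplices. -/
theorem exists_minNonSimplices_of_mem_freeToricDims {K : PreAbstractSimplicialComplex (Fin m)}
    {r s : ℕ} (hs : s ∈ freeToricDims K) (hr : r ≤ s) :
    ∃ τ : (Fin r → Bool) → Finset (Fin m), (∀ b, b ≠ (fun _ => false) → τ b ∈ minNonSimplices K) ∧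
      ∀ b b', b ≠ (fun _ => false) → b' ≠ (fun _ => false) → b ≠ b' →
        τ b ∩ τ b' ∩ τ (fun j => xor (b j) (b' j)) = ∅ := by
  classical
  obtain ⟨H, ⟨e⟩, hH⟩ := hs
  obtain ⟨c, hc1, hc2⟩ : ∃ c : Circle, c ≠ 1 ∧ c * c = 1 := by
    refine ⟨Circle.exp Real.pi, fun h => ?_, ?_⟩
    · have h2 := congrArg (fun z : Circle => (z : ℂ)) h
      norm_num [Circle.coe_exp, Complex.exp_pi_mul_I] at h2
    · ext
      simp [Circle.coe_exp, Complex.exp_pi_mul_I]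
  -- F₂^r sits in the 2-torsion of the first r coordinates of T^s; the other coordinates are padded
  -- with 1.
  let x : (Fin r → Bool) → (Fin s → Circle) := fun b i =>
    if h : (i : ℕ) < r then (if b ⟨i, h⟩ then c else 1) else 1
  have hx : ∀ b b', x (fun j => xor (b j) (b' j)) = x b * x b' := by
    intro b b'
    funext i
    by_cases h : (i : ℕ) < r
    · cases h1 : b ⟨i, h⟩ <;> cases h2 : b' ⟨i, h⟩ <;> simp [x, h, h1, h2, hc2]
    · simp [x, h]
  have hx0 : x (fun _ => false) = 1 := by
    funext i
    simp [x]
  have hx1 : ∀ b, b ≠ (fun _ => false) → x b ≠ 1 := by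
    intro b hb h
    refine hb (funext fun j => ?_)
    have hj := congrFun h ⟨j, j.2.trans_le hr⟩
    cases hbj : b j
    · rfl
    · exact absurd (by simpa [x, hbj] using hj) hc1
  let y : (Fin r → Bool) → (Fin m → Circle) := fun b => (e.symm (x b) : H)
  have hy : ∀ b b', y (fun j => xor (b j) (b' j)) = y b * y b' := by
    intro b b'
    simp only [y, hx, map_mul, Subgroup.coe_mul]
  have hy1 : ∀ b, b ≠ (fun _ => false) → y b ≠ 1 := by
    intro b hb h
    refine hx1 b hb (e.symm.injective (Subtype.ext ?_))
    rw [map_one]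
    exact h
  have hneg : ∀ b i, y b i ≠ 1 → (y b i : ℂ) = -1 := by
    intro b i h
    have h2 : y b * y b = 1 := by
      rw [← hy]
      simp [y, hx0]
    have h3 := congrArg (fun z : Circle => (z : ℂ)) (congrFun h2 i)
    simp only [Pi.mul_apply, Pi.one_apply, Circle.coe_mul, Circle.coe_one] at h3
    exact (mul_self_eq_one_iff.mp h3).resolve_left fun h4 => h (Circle.ext (by simpa using h4))
  let ω : (Fin r → Bool) → Finset (Fin m) := fun b => Finset.univ.filter fun i => y b i ≠ 1
  have hω : ∀ b, b ≠ (fun _ => false) → ¬ IsSimplex K (ω b) := fun b hb =>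
    not_isSimplex_support hH (e.symm (x b)).2 (hy1 b hb) (by simp [ω, y])
  have hτ : ∀ b, ∃ τ, b ≠ (fun _ => false) → τ ∈ minNonSimplices K ∧ τ ⊆ ω b := by
    intro b
    by_cases hb : b = fun _ => false
    · exact ⟨∅, fun h => absurd hb h⟩
    · obtain ⟨τ, h1, h2⟩ := exists_minNonSimplices_subset _ (hω b hb)
      exact ⟨τ, fun _ => ⟨h1, h2⟩⟩
  choose τ hτ using hτ
  refine ⟨τ, fun b hb => (hτ b hb).1, fun b b' hb hb' hne => ?_⟩
  have hbb : (fun j => xor (b j) (b' j)) ≠ fun _ => false := by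
    intro h
    refine hne (funext fun j => ?_)
    simpa using congrFun h j
  refine Finset.eq_empty_of_forall_notMem fun i hi => ?_
  simp only [Finset.mem_inter] at hi
  have h1 := (hτ b hb).2 hi.1.1
  have h2 := (hτ b' hb').2 hi.1.2
  have h3 := (hτ _ hbb).2 hi.2
  simp only [ω, Finset.mem_filter, Finset.mem_univ, true_and] at h1 h2 h3
  -- At a common vertex the third sign would be (-1)(-1) = 1, against membership in its support.
  refine h3 (Circle.ext ?_)
  rw [hy, Pi.mul_apply, Circle.coe_mul, hneg b i h1, hneg b' i h2]
  simp

/-! ### From exponent vectors to free tori -/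

/-- The homomorphism of tori with exponents zero and one given by `a`. -/
noncomputable def monomialHom {r : ℕ} (a : Fin m → Fin r → Bool) :
    (Fin r → Circle) →* (Fin m → Circle) where
  toFun t i := ∏ j, if a i j then t j else 1
  map_one' := by
    funext i
    simp
  map_mul' t t' := by
    funext i
    rw [Pi.mul_apply, ← Finset.prod_mul_distrib]
    refine Finset.prod_congr rfl fun j _ => ?_
    split <;> simp

theorem monomialHom_apply {r : ℕ} (a : Fin m → Fin r → Bool) (t : Fin r → Circle) (i : Fin m) :
    monomialHom a t i = ∏ j, if a i j then t j else 1 := rfl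

theorem continuous_monomialHom {r : ℕ} (a : Fin m → Fin r → Bool) :
    Continuous (monomialHom a) := by
  refine continuous_pi fun i => ?_
  simp only [monomialHom_apply]
  refine continuous_finsetProd _ fun j _ => ?_
  cases a i j
  · simpa using continuous_const
  · simpa using continuous_apply j

/-- An element fixing a point is 1 at every coordinate of modulus one, hence off a simplex, which is
the situation of `h`. The case σ = ∅ gives injectivity, and compactness makes the bijection onto the
image a homeomorphism. -/
theorem mem_freeToricDims_of_monomialHom {K : PreAbstractSimplicialComplex (Fin m)} {r : ℕ}
    (a : Fin m → Fin r → Bool)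
    (h : ∀ σ, IsSimplex K σ → ∀ t, (∀ i, i ∉ σ → monomialHom a t i = 1) → t = 1) :
    r ∈ freeToricDims K := by
  have hinj : Function.Injective (monomialHom a) := by
    rw [injective_iff_map_eq_one]
    intro t ht
    exact h ∅ (.inl rfl) t fun i _ => congrFun ht i
  let e := MonoidHom.ofInjective hinj
  have he : Continuous e := (continuous_monomialHom a).subtype_mk _
  refine ⟨(monomialHom a).range, ⟨ContinuousMulEquiv.symm
    { e with
      continuous_toFun := he
      continuous_invFun := he.continuous_symm_of_equiv_compact_to_t2 (f := e.toEquiv) }⟩, ?_⟩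
  rintro _ ⟨t, rfl⟩ z hz hfix
  rw [h _ hz.2 t, map_one]
  intro i hi
  have hi' : ‖z i‖ = 1 := by simpa using hi
  have hz0 : z i ≠ 0 := by
    rw [← norm_ne_zero_iff, hi']
    exact one_ne_zero
  have := congrFun hfix i
  refine Circle.ext ?_
  simpa using (mul_eq_right₀ hz0).mp this

/-! ### The bounds one, two and three -/

theorem le_buchstaberInvariant {K : PreAbstractSimplicialComplex (Fin m)} {r : ℕ}
    (h : r ∈ freeToricDims K) : r ≤ buchstaberInvariant K :=
  (isGreatest_buchstaberInvariant K).2 h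

theorem one_le_buchstaberInvariant_iff {K : PreAbstractSimplicialComplex (Fin m)} :
    1 ≤ buchstaberInvariant K ↔ (minNonSimplices K).Nonempty := by
  classical
  constructor
  · intro h
    obtain ⟨τ, hτ, -⟩ :=
      exists_minNonSimplices_of_mem_freeToricDims (isGreatest_buchstaberInvariant K).1 h
    exact ⟨_, hτ (fun _ => true) (by decide)⟩
  · rintro ⟨τ, hτ⟩
    refine le_buchstaberInvariant (mem_freeToricDims_of_monomialHom
      (fun i _ => decide (i ∈ τ)) fun σ hσ t ht => ?_)
    obtain ⟨i, hi, hiτ⟩ := exists_mem_notMem_of_mem_minNonSimplices hτ hσ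
    funext j
    simpa [monomialHom_apply, hiτ, Subsingleton.elim j 0] using ht i hi

theorem two_le_buchstaberInvariant_iff {K : PreAbstractSimplicialComplex (Fin m)} :
    2 ≤ buchstaberInvariant K ↔ ∃ τ₁ ∈ minNonSimplices K, ∃ τ₂ ∈ minNonSimplices K,
      ∃ τ₃ ∈ minNonSimplices K, τ₁ ∩ τ₂ ∩ τ₃ = ∅ := by
  classical
  constructor
  · intro h
    obtain ⟨τ, hτ, hτ'⟩ :=
      exists_minNonSimplices_of_mem_freeToricDims (isGreatest_buchstaberInvariant K).1 h
    exact ⟨_, hτ ![true, false] (by decide), _, hτ ![false, true] (by decide), _,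
      hτ _ (by decide), hτ' _ _ (by decide) (by decide) (by decide)⟩
  · rintro ⟨τ₁, h₁, τ₂, h₂, τ₃, h₃, h⟩
    -- The forms a₀, a₁, a₀ + a₁ are pairwise independent, and each vertex imposes at most two of
    -- the three equations.
    have ha : ∀ i, ∃ a : Fin 2 → Bool, (i ∈ τ₁ → a 0) ∧ (i ∈ τ₂ → a 1) ∧
        (i ∈ τ₃ → xor (a 0) (a 1)) := by
      intro i
      have hi : ¬ (i ∈ τ₁ ∧ i ∈ τ₂ ∧ i ∈ τ₃) := by
        rw [← and_assoc, ← Finset.mem_inter, ← Finset.mem_inter, h]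
        exact Finset.notMem_empty i
      have key : ∀ p q s : Bool, ¬ (p ∧ q ∧ s) →
          ∃ a : Fin 2 → Bool, (p → a 0) ∧ (q → a 1) ∧ (s → xor (a 0) (a 1)) := by decide
      simpa using key (decide (i ∈ τ₁)) (decide (i ∈ τ₂)) (decide (i ∈ τ₃)) (by simpa using hi)
    choose a ha using ha
    refine le_buchstaberInvariant (mem_freeToricDims_of_monomialHom a fun σ hσ t ht => ?_)
    simp only [monomialHom_apply, Fin.prod_univ_two] at ht
    have e₁ : t 0 = 1 ∨ t 0 * t 1 = 1 := by
      obtain ⟨i, hi, hiτ⟩ := exists_mem_notMem_of_mem_minNonSimplices h₁ hσ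
      have := ht i hi
      have := (ha i).1 hiτ
      cases h : a i 1 <;> simp_all
    have e₂ : t 1 = 1 ∨ t 0 * t 1 = 1 := by
      obtain ⟨i, hi, hiτ⟩ := exists_mem_notMem_of_mem_minNonSimplices h₂ hσ
      have := ht i hi
      have := (ha i).2.1 hiτ
      cases h : a i 0 <;> simp_all
    have e₃ : t 0 = 1 ∨ t 1 = 1 := by
      obtain ⟨i, hi, hiτ⟩ := exists_mem_notMem_of_mem_minNonSimplices h₃ hσ
      have := ht i hi
      have := (ha i).2.2 hiτ
      cases h : a i 0 <;> cases h' : a i 1 <;> simp_all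
    have : t 0 = 1 ∧ t 1 = 1 := by
      rcases e₃ with h | h
      · simp_all
      · simp_all
    funext j
    fin_cases j
    · exact this.1
    · exact this.2

/-- Each hypothesis lists the four 0/1 monomials on which one nonzero linear form mod 2 takes the
value 1. Seven choices of trivial monomials, one per form, have exponent vectors spanning F₂³, and
three of these with determinant ±1 force triviality. -/
theorem eq_one_of_relations {G : Type*} [CommGroup G] {x y z : G}
    (h₁ : x = 1 ∨ x * y = 1 ∨ x * z = 1 ∨ x * y * z = 1)
    (h₂ : y = 1 ∨ x * y = 1 ∨ y * z = 1 ∨ x * y * z = 1)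
    (h₃ : z = 1 ∨ x * z = 1 ∨ y * z = 1 ∨ x * y * z = 1)
    (h₄ : x = 1 ∨ y = 1 ∨ x * z = 1 ∨ y * z = 1)
    (h₅ : x = 1 ∨ z = 1 ∨ x * y = 1 ∨ y * z = 1)
    (h₆ : y = 1 ∨ z = 1 ∨ x * y = 1 ∨ x * z = 1)
    (h₇ : x = 1 ∨ y = 1 ∨ z = 1 ∨ x * y * z = 1) : x = 1 ∧ y = 1 ∧ z = 1 := by
  have hx : y * z = 1 → x * y * z = 1 → x = 1 := fun h h' => by rwa [mul_assoc, h, mul_one] at h'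
  have hy : x * z = 1 → x * y * z = 1 → y = 1 := fun h h' => by
    rwa [mul_right_comm, h, one_mul] at h'
  have hz : x * y = 1 → x * y * z = 1 → z = 1 := fun h h' => by rwa [h, one_mul] at h'
  by_cases ex : x = 1
  · subst ex
    simp only [one_mul, true_and] at *
    by_cases ey : y = 1
    · simp_all
    · by_cases ez : z = 1 <;> simp_all
  by_cases ey : y = 1
  · subst ey
    simp only [one_mul, mul_one, true_and] at *
    by_cases ez : z = 1 <;> simp_all
  by_cases ez : z = 1
  · subst ez
    simp_all
  -- With no variable trivial, `h₇` leaves only the full product; comparing it with the product of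
  -- two variables allowed by `h₄` makes a third variable trivial.
  have e : x * y * z = 1 := by simpa only [ex, ey, ez, false_or] using h₇
  rcases h₄ with h | h | h | h
  · exact (ex h).elim
  · exact (ey h).elim
  · exact (ey (hy h e)).elim
  · exact (ex (hx h e)).elim

/-- This translates a vertex's trivial character into the hypotheses of `eq_one_of_relations`: a
nonzero value of a form leaves four possible exponent vectors. -/
theorem relation_of_prod_eq_one {G : Type*} [CommGroup G] {x y z : G} (p q s : Bool)
    (h : (if p then x else 1) * (if q then y else 1) * (if s then z else 1) = 1) :
    (p → x = 1 ∨ x * y = 1 ∨ x * z = 1 ∨ x * y * z = 1) ∧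
    (q → y = 1 ∨ x * y = 1 ∨ y * z = 1 ∨ x * y * z = 1) ∧
    (s → z = 1 ∨ x * z = 1 ∨ y * z = 1 ∨ x * y * z = 1) ∧
    (xor p q → x = 1 ∨ y = 1 ∨ x * z = 1 ∨ y * z = 1) ∧
    (xor p s → x = 1 ∨ z = 1 ∨ x * y = 1 ∨ y * z = 1) ∧
    (xor q s → y = 1 ∨ z = 1 ∨ x * y = 1 ∨ x * z = 1) ∧
    (xor p (xor q s) → x = 1 ∨ y = 1 ∨ z = 1 ∨ x * y * z = 1) := by
  cases p <;> cases q <;> cases s <;> simp at h ⊢ <;> simp [h]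

set_option synthInstance.maxSize 1000 in
set_option synthInstance.maxHeartbeats 400000 in
set_option maxRecDepth 10000 in
/-- Seven affine equations over the field with two elements, one for each nonzero linear form in
three variables, are solvable if no three forms in the system sum to zero. -/
theorem exists_affine_solution : ∀ b₁ b₂ b₃ b₄ b₅ b₆ b₇ : Bool,
    ((b₁ → b₂ → ¬ b₄) ∧ (b₁ → b₃ → ¬ b₅) ∧ (b₁ → b₆ → ¬ b₇) ∧ (b₂ → b₃ → ¬ b₆) ∧
      (b₂ → b₅ → ¬ b₇) ∧ (b₃ → b₄ → ¬ b₇) ∧ (b₄ → b₅ → ¬ b₆)) →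
    ∃ p q s : Bool, (b₁ → p) ∧ (b₂ → q) ∧ (b₃ → s) ∧ (b₄ → xor p q) ∧ (b₅ → xor p s) ∧
      (b₆ → xor q s) ∧ (b₇ → xor p (xor q s)) := by
  decide

theorem three_le_buchstaberInvariant_iff {K : PreAbstractSimplicialComplex (Fin m)} :
    3 ≤ buchstaberInvariant K ↔ ∃ τ₁ ∈ minNonSimplices K, ∃ τ₂ ∈ minNonSimplices K,
      ∃ τ₃ ∈ minNonSimplices K, ∃ τ₄ ∈ minNonSimplices K, ∃ τ₅ ∈ minNonSimplices K,
      ∃ τ₆ ∈ minNonSimplices K, ∃ τ₇ ∈ minNonSimplices K,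
        PatternOne τ₁ τ₂ τ₃ τ₄ τ₅ τ₆ τ₇ := by
  classical
  constructor
  · intro h
    obtain ⟨τ, hτ, hτ'⟩ :=
      exists_minNonSimplices_of_mem_freeToricDims (isGreatest_buchstaberInvariant K).1 h
    have key : ∀ a b c : Fin 3 → Bool, a ≠ (fun _ => false) → b ≠ (fun _ => false) → a ≠ b →
        (fun j => xor (a j) (b j)) = c → ∀ x, x ∈ τ a → x ∈ τ b → x ∉ τ c := by
      rintro a b c ha hb hab rfl x hxa hxb hxc
      have := hτ' a b ha hb hab
      exact Finset.notMem_empty x (this ▸ by simp [hxa, hxb, hxc])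
    -- The order of the indices matches the forms p, q, s, p+q, p+s, q+s, p+q+s, so that the seven
    -- conditions of `PatternOne` are the lines of the Fano plane.
    refine ⟨_, hτ ![true, false, false] (by decide), _, hτ ![false, true, false] (by decide),
      _, hτ ![false, false, true] (by decide), _, hτ ![true, true, false] (by decide),
      _, hτ ![true, false, true] (by decide), _, hτ ![false, true, true] (by decide),
      _, hτ ![true, true, true] (by decide), fun x => ?_⟩
    refine ⟨?_, ?_, ?_, ?_, ?_, ?_, ?_⟩ <;>
      exact key _ _ _ (by decide) (by decide) (by decide) (by decide) x
  · rintro ⟨τ₁, h₁, τ₂, h₂, τ₃, h₃, τ₄, h₄, τ₅, h₅, τ₆, h₆, τ₇, h₇, h⟩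
    have ha : ∀ i, ∃ p q s : Bool, (i ∈ τ₁ → p) ∧ (i ∈ τ₂ → q) ∧ (i ∈ τ₃ → s) ∧
        (i ∈ τ₄ → xor p q) ∧ (i ∈ τ₅ → xor p s) ∧ (i ∈ τ₆ → xor q s) ∧
        (i ∈ τ₇ → xor p (xor q s)) := by
      intro i
      have := exists_affine_solution (decide (i ∈ τ₁)) (decide (i ∈ τ₂)) (decide (i ∈ τ₃)) (decide (i ∈ τ₄))
        (decide (i ∈ τ₅)) (decide (i ∈ τ₆)) (decide (i ∈ τ₇))
      simp only [decide_eq_true_eq] at this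
      exact this (h i)
    choose p q s ha using ha
    refine le_buchstaberInvariant (mem_freeToricDims_of_monomialHom (fun i => ![p i, q i, s i])
      fun σ hσ t ht => ?_)
    -- The simplex σ misses a vertex of every minimal non-simplex, and the character at that vertex
    -- is trivial on `t`.
    have hrel : ∀ {τ}, τ ∈ minNonSimplices K → ∃ i, i ∈ τ ∧
        (if p i then t 0 else 1) * (if q i then t 1 else 1) * (if s i then t 2 else 1) = 1 := by
      intro τ hτ
      obtain ⟨i, hi, hiτ⟩ := exists_mem_notMem_of_mem_minNonSimplices hτ hσ
      have := ht i hi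
      rw [monomialHom_apply, Fin.prod_univ_three] at this
      exact ⟨i, hiτ, this⟩
    obtain ⟨e₀, e₁, e₂⟩ : t 0 = 1 ∧ t 1 = 1 ∧ t 2 = 1 := by
      apply eq_one_of_relations
      · obtain ⟨i, hi, hrel⟩ := hrel h₁
        exact (relation_of_prod_eq_one _ _ _ hrel).1 ((ha i).1 hi)
      · obtain ⟨i, hi, hrel⟩ := hrel h₂
        exact (relation_of_prod_eq_one _ _ _ hrel).2.1 ((ha i).2.1 hi)
      · obtain ⟨i, hi, hrel⟩ := hrel h₃
        exact (relation_of_prod_eq_one _ _ _ hrel).2.2.1 ((ha i).2.2.1 hi)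
      · obtain ⟨i, hi, hrel⟩ := hrel h₄
        exact (relation_of_prod_eq_one _ _ _ hrel).2.2.2.1 ((ha i).2.2.2.1 hi)
      · obtain ⟨i, hi, hrel⟩ := hrel h₅
        exact (relation_of_prod_eq_one _ _ _ hrel).2.2.2.2.1 ((ha i).2.2.2.2.1 hi)
      · obtain ⟨i, hi, hrel⟩ := hrel h₆
        exact (relation_of_prod_eq_one _ _ _ hrel).2.2.2.2.2.1 ((ha i).2.2.2.2.2.1 hi)
      · obtain ⟨i, hi, hrel⟩ := hrel h₇
        exact (relation_of_prod_eq_one _ _ _ hrel).2.2.2.2.2.2 ((ha i).2.2.2.2.2.2 hi)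
    funext j
    fin_cases j
    exacts [e₀, e₁, e₂]

/-! ### Passing to distinct sets and reading off the exact values -/

theorem three_le_buchstaberInvariant_iff_config {K : PreAbstractSimplicialComplex (Fin m)} :
    3 ≤ buchstaberInvariant K ↔ ConfigOne (minNonSimplices K) ∨ ConfigTwo (minNonSimplices K) ∨
      ConfigThree (minNonSimplices K) ∨ ConfigFour (minNonSimplices K) ∨
      ConfigFive (minNonSimplices K) := by
  rw [three_le_buchstaberInvariant_iff]
  constructor
  · rintro ⟨τ₁, h₁, τ₂, h₂, τ₃, h₃, τ₄, h₄, τ₅, h₅, τ₆, h₆, τ₇, h₇, h⟩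
    exact config_of_patternOne nonempty_of_mem_minNonSimplices h₁ h₂ h₃ h₄ h₅ h₆ h₇ h
  · exact exists_patternOne

theorem two_le_buchstaberInvariant_iff_hasDisjointPairOrTriple
    {K : PreAbstractSimplicialComplex (Fin m)} :
    2 ≤ buchstaberInvariant K ↔ HasDisjointPairOrTriple (minNonSimplices K) := by
  rw [two_le_buchstaberInvariant_iff,
    hasDisjointPairOrTriple_iff nonempty_of_mem_minNonSimplices]

end Buchstaber

theorem mainTheorem2 (m : ℕ) (K : PreAbstractSimplicialComplex (Fin m)) :
    ((Buchstaber.buchstaberInvariant K = 0 ↔ Buchstaber.minNonSimplices K = ∅) ∧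
      (Buchstaber.buchstaberInvariant K = 0 ↔ Buchstaber.IsFullSimplex K)) ∧
    (Buchstaber.buchstaberInvariant K = 1 ↔
      (Buchstaber.minNonSimplices K).Nonempty ∧
      (∀ τ₁ ∈ Buchstaber.minNonSimplices K, ∀ τ₂ ∈ Buchstaber.minNonSimplices K,
        [τ₁, τ₂].Nodup → (τ₁ ∩ τ₂).Nonempty) ∧
      (∀ τ₁ ∈ Buchstaber.minNonSimplices K, ∀ τ₂ ∈ Buchstaber.minNonSimplices K,
        ∀ τ₃ ∈ Buchstaber.minNonSimplices K,
        [τ₁, τ₂, τ₃].Nodup → (τ₁ ∩ τ₂ ∩ τ₃).Nonempty)) ∧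
    (Buchstaber.buchstaberInvariant K = 2 ↔
      Buchstaber.HasDisjointPairOrTriple (Buchstaber.minNonSimplices K) ∧
      ¬ Buchstaber.ConfigOne (Buchstaber.minNonSimplices K) ∧
      ¬ Buchstaber.ConfigTwo (Buchstaber.minNonSimplices K) ∧
      ¬ Buchstaber.ConfigThree (Buchstaber.minNonSimplices K) ∧
      ¬ Buchstaber.ConfigFour (Buchstaber.minNonSimplices K) ∧
      ¬ Buchstaber.ConfigFive (Buchstaber.minNonSimplices K)) := by
  have hzero : Buchstaber.buchstaberInvariant K = 0 ↔ Buchstaber.minNonSimplices K = ∅ := by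
    rw [← Set.not_nonempty_iff_eq_empty, ← Buchstaber.one_le_buchstaberInvariant_iff]
    omega
  refine ⟨⟨hzero, hzero.trans Buchstaber.isFullSimplex_iff_minNonSimplices_eq_empty.symm⟩, ?_, ?_⟩
  · rw [← Buchstaber.one_le_buchstaberInvariant_iff]
    trans 1 ≤ Buchstaber.buchstaberInvariant K ∧ ¬ 2 ≤ Buchstaber.buchstaberInvariant K
    · omega
    refine and_congr_right fun _ => ?_
    rw [Buchstaber.two_le_buchstaberInvariant_iff_hasDisjointPairOrTriple,
      Buchstaber.HasDisjointPairOrTriple, not_or]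
    simp only [not_exists, not_and, Finset.nonempty_iff_ne_empty, ne_eq]
  · trans 2 ≤ Buchstaber.buchstaberInvariant K ∧ ¬ 3 ≤ Buchstaber.buchstaberInvariant K
    · omega
    rw [Buchstaber.two_le_buchstaberInvariant_iff_hasDisjointPairOrTriple,
      Buchstaber.three_le_buchstaberInvariant_iff_config]
    simp only [not_or]
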